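/- **Setting.** Let $\alpha\in[0,1)$, $S_A>0$, $c_{\mathrm{TX}}>0$, $\phi>0$, $\theta=\phi/c_{\mathrm{TX}}$, and integers $1\le B\le N_S$. In each slot $k=0,1,2,\dots$ a fusion center sends to the $N_S$ sensor nodes (SNs) an instruction $\mathbf D_k=(A_{n,k},S_{M,n,k},B_{n,k})_{n=1}^{N_S}$, where either $A_{n,k}=0$, $S_{M,n,k}=0$, $B_{n,k}=0$ (idle), or $A_{n,k}=1$, $S_{M,n,k}\ge 0$ and $B_{n,k}\in\{1,\dots,B\}$. The cost of SN $n$ in slot $k$ is $c_{SN}(A_{n,k},S_{M,n,k})=A_{n,k}(c_{\mathrm{TX}}+\phi S_{M,n,k})$. The transmission of SN $n$ succeeds ($O_{n,k}=1$, otherwise $O_{n,k}=0$) iff $A_{n,k}=1$ and no other active SN uses the same channel. In the best-$\gamma$ scenario (all accuracy states equal to $\gamma_{\max}=1$) the aggregate SNR is $$\Lambda_k=\sum_{n=1}^{N_S}O_{n,k}\frac{S_AS_{M,n,k}}{S_A+S_{M,n,k}} .$$ The prior and posterior (Kalman) variances are $V_0=1$, $\hat V_k=\frac{V_k}{1+V_k\Lambda_k}$,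 $V_{k+1}=1-\alpha(1-\hat V_k)$; $\hat V_k$ is the MSE in slot $k$. A (coordinated) policy $\delta$ is a sequence of stochastic kernels $\delta_k(\cdot\mid V)$; given the past, $\mathbf D_k$ is drawn from $\delta_k(\cdot\mid V_k)$. Put $$\bar M^T_\delta=\mathbb E_\delta\Big[\tfrac1{T+1}\sum_{k=0}^T\hat V_k\Big],\qquad \bar C^{T,n}_\delta=\mathbb E_\delta\Big[\tfrac1{T+1}\sum_{k=0}^T c_{SN}(A_{n,k},S_{M,n,k})\Big]\in[0,\infty],$$ $\bar M_\delta=\limsup_{T\to\infty}\bar M_\delta^T$ and $\bar C^n_\delta=\limsup_{T\to\infty}\bar C^{T,n}_\delta$. For $\epsilon>0$, $\delta$ is feasible if $\bar C^n_\delta\le\epsilon/N_S$ for all $n$, and optimal if it minimizes $\bar M_\delta$ among the feasible policies. Let $$\bar\Lambda^*=\max\ \mathbb E[\Lambda]\quad\text{subject to}\quad \mathbb E[c_{SN}(A_n,S_{M,n})]\le \epsilon/N_S\ \ \forall n,$$ the maximum being over the probability distributions of a single instruction. A MAX-SNR scheme is a policy that, in every slot and independently of $V_k$, draws the instruction from one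 fixed maximizer of this problem. Finally let $$\hat\nu^*(x)=\frac{\sqrt{(1-\alpha)^2(1+x^2)+2(1-\alpha^2)x}-(1-\alpha)(1+x)}{2\alpha x},$$ read as its limit $\frac1{1+x}$ if $\alpha=0$ or $x=0$. For an integer $0\le t\le B$ and $S_M\ge0$ let $\delta^{(t,S_M)}$ be the policy that in every slot assigns, by a uniformly random permutation of the SNs, $t$ active actions $(1,S_M,i)$, $i=1,\dots,t$, and $N_S-t$ idle actions (so $t$ uniformly random SNs are active, on distinct channels, with local measurement SNR $S_M$). **Theorem.** Let either (i) $\epsilon=t\,c_{\mathrm{TX}}(1+\sqrt{\theta S_A})$ for some $t\in\{1,\dots,B\}$, and $S_M=\sqrt{S_A/\theta}$; or (ii) $\epsilon>B\,c_{\mathrm{TX}}(1+\sqrt{\theta S_A})$, $t=B$, and $S_M=\frac1\theta\left(\frac{\epsilon}{Bc_{\mathrm{TX}}}-1\right)$. Let $\Lambda=t\,\frac{S_AS_M}{S_A+S_M}$. Then $\delta^*=\delta^{(t,S_M)}$ is optimal and is a MAX-SNR scheme; almost surely $\Lambda_k=\Lambda$ for all $k$, and $\bar\Lambda^*=\Lambda$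 (the maximum is attained). Moreover $\bar M_{\delta^*}=\hat\nu^*(\Lambda)$ and $\bar C^n_{\delta^*}=\epsilon/N_S$ for every $n$, both upper limits being limits. Every feasible policy $\delta$ satisfies $\liminf_{T\to\infty}\bar M^T_\delta\ge\hat\nu^*(\bar\Lambda^*)$, so $\delta^*$ attains this lower bound. -/

import Mathlib

open MeasureTheory ProbabilityTheory Filter Topology
open scoped NNReal ENNReal

noncomputable section

namespace WSN

/-- Parameters of the sensor network: time-correlation `alpha`, local ambient SNR `SA`,
transmission cost `cTX`, unitary sensing cost `phi`, number of sensor nodes `NS`, number of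
channels `B`. -/
structure Network where
  alpha : ℝ
  SA : ℝ
  cTX : ℝ
  phi : ℝ
  NS : ℕ
  B : ℕ

/-- The normalized unitary sensing cost. -/
def Network.theta (W : Network) : ℝ := W.phi / W.cTX

/-- The standing assumptions on the parameters. -/
structure Network.Admissible (W : Network) : Prop where
  alpha_nonneg : 0 ≤ W.alpha
  alpha_lt_one : W.alpha < 1
  SA_pos : 0 < W.SA
  cTX_pos : 0 < W.cTX
  phi_pos : 0 < W.phi
  B_pos : 1 ≤ W.B
  B_le_NS : W.B ≤ W.NS

/-! ### Kalman filter variances -/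

/-- Prior variance in the next slot as a function of the posterior variance in this slot
(unit power normalization `σ_Z² = 1 - α`). -/
def nu (α v : ℝ) : ℝ := 1 - α * (1 - v)

/-- Posterior variance from the prior variance `V` and the collected aggregate SNR `Λ`. -/
def nuHat (V Λ : ℝ) : ℝ := V / (1 + V * Λ)

/-- Posterior variance (mean squared error) at the end of slot `k`, with initial prior variance
`V0` and aggregate SNR sequence `Λ`. -/
def postVar (α V0 : ℝ) (Λ : ℕ → ℝ) : ℕ → ℝ
  | 0 => nuHat V0 (Λ 0)
  | k + 1 => nuHat (nu α (postVar α V0 Λ k)) (Λ (k + 1))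

/-- Prior variance at the beginning of slot `k`. -/
def priorVar (α V0 : ℝ) (Λ : ℕ → ℝ) : ℕ → ℝ
  | 0 => V0
  | k + 1 => nu α (postVar α V0 Λ k)

/-- Sample average MSE over the slots `0, …, T`. -/
def sampleMSE (α V0 : ℝ) (T : ℕ) (Λ : ℕ → ℝ) : ℝ :=
  (1 / ((T : ℝ) + 1)) * ∑ k ∈ Finset.range (T + 1), postVar α V0 Λ k

/-- The function `ν̂*`. Where the denominator `2 α x` vanishes (`α = 0` or `x = 0`) the quotient is
`0/0`; it is extended there by its limit, which is `1 / (1 + x)` in both cases. -/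
def nuStar (α x : ℝ) : ℝ :=
  if α * x = 0 then 1 / (1 + x)
  else (Real.sqrt ((1 - α) ^ 2 * (1 + x ^ 2) + 2 * (1 - α ^ 2) * x) - (1 - α) * (1 + x))
    / (2 * α * x)

/-! ### Actions and instructions of the coordinated scheme -/

/-- A sensing-transmission action `(A, S_M, channel)` of one sensor node. The channel index is in
`{0, …, B}`, where `0` means that no channel is selected; an idle node has `S_M = 0` and no
channel, an active node selects one of the channels `1, …, B`. -/
abbrev Action (B : ℕ) : Type :=
  {a : Bool × ℝ≥0 × Fin (B + 1) //
    (a.1 = false → a.2.1 = 0 ∧ a.2.2 = 0) ∧ (a.1 = true → a.2.2 ≠ 0)}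

/-- Whether the node is active. -/
def Action.active {B : ℕ} (a : Action B) : Bool := a.1.1

/-- The local measurement SNR. -/
def Action.snr {B : ℕ} (a : Action B) : ℝ≥0 := a.1.2.1

/-- The channel index. -/
def Action.channel {B : ℕ} (a : Action B) : Fin (B + 1) := a.1.2.2

/-- An instruction: one action for each sensor node. -/
abbrev Instruction (W : Network) : Type := Fin W.NS → Action W.B

/-- Sensing-transmission cost of a single action. -/
def cost (W : Network) (a : Action W.B) : ℝ :=
  if a.active = true then W.cTX + W.phi * (a.snr : ℝ) else 0

/-- Transmission outcome in the collision channel model: node `n` succeeds iff it is active and no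
other active node uses its channel. -/
def success {W : Network} (D : Instruction W) (n : Fin W.NS) : Bool :=
  decide ((D n).active = true ∧
    ∀ m, m ≠ n → (D m).active = true → (D m).channel ≠ (D n).channel)

/-- Local SNR of a measurement taken in accuracy state `γ` with local measurement SNR `S`. -/
def localSNR (SA γ S : ℝ) : ℝ := γ ^ 2 * (SA * S / (SA + S))

/-- Aggregate SNR collected at the fusion center under the instruction `D`, when all nodes have
the best accuracy state `γ_max = 1`. -/
def aggSNR {W : Network} (D : Instruction W) : ℝ :=
  ∑ n, if success D n = true then localSNR W.SA 1 ((D n).snr : ℝ) else 0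

lemma measurable_aggSNR (W : Network) : Measurable (aggSNR : Instruction W → ℝ) := by
  unfold aggSNR
  refine Finset.measurable_sum _ fun n _ => ?_
  have h1 : Measurable (fun D : Instruction W => success D n) := by
    have hf : Measurable (fun D : Instruction W =>
        (fun m => ((D m).1.1, (D m).1.2.2) : Fin W.NS → Bool × Fin (W.B + 1))) := by
      fun_prop
    exact (measurable_of_finite
      (fun g : Fin W.NS → Bool × Fin (W.B + 1) =>
        decide ((g n).1 = true ∧ ∀ m, m ≠ n → (g m).1 = true → (g m).2 ≠ (g n).2))).comp hf
  have h2 : Measurable (fun D : Instruction W => ((D n).snr : ℝ)) := by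
    unfold Action.snr
    fun_prop
  refine Measurable.ite (h1 (measurableSet_singleton true)) ?_ measurable_const
  unfold localSNR
  fun_prop

/-! ### Instruction policies and the process they induce -/

/-- A (possibly randomized and non-stationary) instruction policy: in slot `k` the instruction is
drawn from `kernel k V`, where `V` is the current prior variance. -/
structure Policy (W : Network) where
  kernel : ℕ → Kernel ℝ (Instruction W)
  isMarkov : ∀ k, IsMarkovKernel (kernel k)

/-- Prior variance in slot `n + 1`, computed (from the initial value `1`) from the instructions
of the slots `0, …, n`. -/
def historyPriorVar (W : Network) (n : ℕ) (h : (i : Finset.Iic n) → Instruction W) : ℝ :=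
  priorVar W.alpha 1
    (fun i => if hi : i ≤ n then aggSNR (h ⟨i, Finset.mem_Iic.2 hi⟩) else 0) (n + 1)

lemma measurable_historyPriorVar (W : Network) (n : ℕ) :
    Measurable (historyPriorVar W n) := by
  have hΛ : ∀ i : ℕ, Measurable (fun h : (i : Finset.Iic n) → Instruction W =>
      if hi : i ≤ n then aggSNR (h ⟨i, Finset.mem_Iic.2 hi⟩) else 0) := by
    intro i
    by_cases hi : i ≤ n
    · simp only [hi, dite_true]
      exact (measurable_aggSNR W).comp (measurable_pi_apply _)
    · simp only [hi, dite_false]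
      exact measurable_const
  have hp : ∀ k : ℕ, Measurable (fun h : (i : Finset.Iic n) → Instruction W =>
      postVar W.alpha 1
        (fun i => if hi : i ≤ n then aggSNR (h ⟨i, Finset.mem_Iic.2 hi⟩) else 0) k) := by
    intro k
    induction k with
    | zero =>
      simp only [postVar, nuHat]
      have := hΛ 0
      fun_prop
    | succ k ih =>
      simp only [postVar, nuHat, nu]
      have := hΛ (k + 1)
      fun_prop
  unfold historyPriorVar
  simp only [priorVar, nu]
  have := hp n
  fun_prop

/-- Conditional law of the instruction of slot `n + 1` given those of the slots `0, …, n`. -/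
def stepKernel {W : Network} (δ : Policy W) (n : ℕ) :
    Kernel ((i : Finset.Iic n) → Instruction W) (Instruction W) :=
  (δ.kernel (n + 1)).comap (historyPriorVar W n) (measurable_historyPriorVar W n)

instance {W : Network} (δ : Policy W) (n : ℕ) : IsMarkovKernel (stepKernel δ n) := by
  have := δ.isMarkov (n + 1)
  unfold stepKernel
  infer_instance

/-- Law of the instruction sequence `(D_k)` induced by a policy, with initial prior variance
`V_0 = 1`. -/
def law {W : Network} (δ : Policy W) : Measure (ℕ → Instruction W) :=
  Kernel.trajMeasure (X := fun _ => Instruction W) (δ.kernel 0 1) (stepKernel δ)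

/-! ### Performance metrics and the optimization problem -/

/-- Average MSE over the slots `0, …, T`. -/
def avgMSE {W : Network} (δ : Policy W) (T : ℕ) : ℝ :=
  ∫ D, sampleMSE W.alpha 1 T (fun k => aggSNR (D k)) ∂(law δ)

/-- Average sensing-transmission cost of node `n` over the slots `0, …, T` (possibly infinite). -/
def avgCost {W : Network} (δ : Policy W) (n : Fin W.NS) (T : ℕ) : ℝ≥0∞ :=
  ∫⁻ D, ENNReal.ofReal
    ((1 / ((T : ℝ) + 1)) * ∑ k ∈ Finset.range (T + 1), cost W (D k n)) ∂(law δ)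

/-- Infinite-horizon average MSE. -/
def longRunMSE {W : Network} (δ : Policy W) : ℝ := limsup (avgMSE δ) atTop

/-- Infinite-horizon average cost of node `n`. -/
def longRunCost {W : Network} (δ : Policy W) (n : Fin W.NS) : ℝ≥0∞ :=
  limsup (avgCost δ n) atTop

/-- Every node meets the cost constraint `ε / N_S`. -/
def IsFeasible {W : Network} (ε : ℝ) (δ : Policy W) : Prop :=
  ∀ n, longRunCost δ n ≤ ENNReal.ofReal (ε / W.NS)

/-- `δ` minimizes the infinite-horizon average MSE under the cost constraints. -/
def IsOptimal {W : Network} (ε : ℝ) (δ : Policy W) : Prop :=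
  IsFeasible ε δ ∧ ∀ δ' : Policy W, IsFeasible ε δ' → longRunMSE δ ≤ longRunMSE δ'

/-! ### The MAX-SNR scheme -/

/-- The expected single-slot cost of every node is at most `ε / N_S` under the law `μ` of the
instruction. -/
def SlotFeasible {W : Network} (ε : ℝ) (μ : Measure (Instruction W)) : Prop :=
  ∀ n, ∫⁻ D, ENNReal.ofReal (cost W (D n)) ∂μ ≤ ENNReal.ofReal (ε / W.NS)

/-- The expected aggregate SNRs attainable in a slot under the cost constraints. The maximum of
this set is `Λ̄*`. -/
def attainableSNR (W : Network) (ε : ℝ) : Set ℝ :=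
  {x | ∃ μ : Measure (Instruction W), IsProbabilityMeasure μ ∧ SlotFeasible ε μ ∧
    x = ∫ D, aggSNR D ∂μ}

/-- A MAX-SNR scheme: a policy which, in every slot and whatever the prior variance, maximizes the
expected aggregate SNR under the single-slot cost constraints, and is non-adaptive (the
same law of the instruction in every slot and for every prior variance). -/
def IsMaxSNR {W : Network} (ε : ℝ) (δ : Policy W) : Prop :=
  ∃ μ : Measure (Instruction W), (∀ k V, δ.kernel k V = μ) ∧
    IsProbabilityMeasure μ ∧ SlotFeasible ε μ ∧
    ∀ μ' : Measure (Instruction W), IsProbabilityMeasure μ' → SlotFeasible ε μ' →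
      ∫ D, aggSNR D ∂μ' ≤ ∫ D, aggSNR D ∂μ

/-! ### The policy that activates `t` uniformly chosen nodes with a common SNR -/

/-- The idle action. -/
def idle (B : ℕ) : Action B := ⟨(false, 0, 0), by simp⟩

/-- The action of an active node transmitting on channel `j + 1 ∈ {1, …, B}`. -/
def activate {B : ℕ} (S : ℝ≥0) (j : ℕ) (hj : j < B) : Action B :=
  ⟨(true, S, ⟨j + 1, by omega⟩), by simp [Fin.ext_iff]⟩

/-- The instruction that assigns, through the permutation `σ` of the nodes, the `t` active actions
(on the channels `1, …, t`) and the idle actions. -/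
def schedule {W : Network} {t : ℕ} (ht : t ≤ W.B) (S : ℝ≥0) (σ : Equiv.Perm (Fin W.NS)) :
    Instruction W :=
  fun n => if h : (σ n : ℕ) < t then activate S (σ n) (h.trans_le ht) else idle W.B

/-- The law of the instruction when the permutation is uniformly random. -/
def uniformSchedule {W : Network} {t : ℕ} (ht : t ≤ W.B) (S : ℝ≥0) : Measure (Instruction W) :=
  ∑ σ : Equiv.Perm (Fin W.NS),
    ((Fintype.card (Equiv.Perm (Fin W.NS)) : ℝ≥0∞)⁻¹) • Measure.dirac (schedule ht S σ)

instance {W : Network} {t : ℕ} (ht : t ≤ W.B) (S : ℝ≥0) :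
    IsProbabilityMeasure (uniformSchedule (W := W) ht S) := by
  constructor
  simp only [uniformSchedule, Measure.coe_finsetSum, Finset.sum_apply, Measure.smul_apply,
    measure_univ, smul_eq_mul, mul_one, Finset.sum_const, Finset.card_univ, nsmul_eq_mul]
  exact ENNReal.mul_inv_cancel (by exact_mod_cast Fintype.card_ne_zero) (ENNReal.natCast_ne_top _)

/-- In every slot, `t` uniformly random nodes are activated with local measurement SNR `S`, on
distinct channels, and the others stay idle. -/
def constantPolicy (W : Network) {t : ℕ} (ht : t ≤ W.B) (S : ℝ≥0) : Policy W where
  kernel _ := Kernel.const ℝ (uniformSchedule ht S)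
  isMarkov _ := inferInstance

end WSN

end

noncomputable section

namespace WSN

/-! The lower bound is weak Lagrangian duality, used twice and along every sample path. First, in
precision form the Kalman update reads `Λ k = 1 / postVar - 1 / priorVar`. With `G y = 1 / y - 1 /
nu α y`, the sum of the SNRs over slots `0, …, T` equals the sum of the `G (postVar)` plus the
telescoped term `1 / priorVar (T + 1) - 1`, which is nonnegative because the prior variance never
exceeds its initial value 1. On `(0, 1]` the function `G` is convex and decreasing, and `nuStar`
inverts it, so the time-average MSE lies above every supporting line of `nuStar` evaluated at the
time-average SNR (`sampleMSE_lower`).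

Second, concavity of the local SNR and the limit of one success per channel bound the aggregate SNR
of any single instruction by an affine function of its total cost, with value `Λ` at total cost `ε`
(`aggSNR_affine_bound`). Composing the two bounds and taking expectations bounds the average MSE by
a function of the expected total cost alone; adaptivity of the policy cannot help. The second bound
by itself also identifies `Λ` as the single-slot maximum.

Both bounds use only the sum of the node constraints. The random permutation splits the total cost
equally, so the constant policy meets each constraint with equality. Its SNR is almost surely
constant, and the variance recursion is then a contraction with fixed point `nuStar α Λ`, so the
bound is attained. -/

/-! ### The stationary posterior variance -/

/-- `nuStar α x` is the positive root of a quadratic polynomial. -/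
lemma nuStar_quadratic {α x : ℝ} (h0 : 0 ≤ α) (h1 : α < 1) (hx : 0 ≤ x) :
    0 < nuStar α x ∧
      α * x * nuStar α x ^ 2 + (1 - α) * (1 + x) * nuStar α x - (1 - α) = 0 := by
  unfold nuStar
  split_ifs with h
  · refine ⟨by positivity, ?_⟩
    rw [h]
    field_simp
    ring
  · have hpos : 0 < α * x := lt_of_le_of_ne (by positivity) (Ne.symm h)
    have hx' : x ≠ 0 := right_ne_zero_of_mul h
    have hα' : α ≠ 0 := left_ne_zero_of_mul h
    have h1' : 0 < 1 - α := by linarith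
    -- The radicand is the discriminant of the quadratic in the statement; this form shows that the
    -- root exceeds `(1 - α) * (1 + x)`.
    have hD : (1 - α) ^ 2 * (1 + x ^ 2) + 2 * (1 - α ^ 2) * x
        = ((1 - α) * (1 + x)) ^ 2 + 4 * (α * x) * (1 - α) := by ring
    rw [hD]
    set r := Real.sqrt (((1 - α) * (1 + x)) ^ 2 + 4 * (α * x) * (1 - α)) with hr
    have hr2 : r ^ 2 = ((1 - α) * (1 + x)) ^ 2 + 4 * (α * x) * (1 - α) :=
      Real.sq_sqrt (by positivity)
    have hlt : (1 - α) * (1 + x) < r := by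
      apply Real.lt_sqrt_of_sq_lt
      have : 0 < 4 * (α * x) * (1 - α) := by positivity
      linarith
    refine ⟨div_pos (by linarith) (by linarith), ?_⟩
    field_simp
    linear_combination hr2

lemma nuStar_pos {α x : ℝ} (h0 : 0 ≤ α) (h1 : α < 1) (hx : 0 ≤ x) : 0 < nuStar α x :=
  (nuStar_quadratic h0 h1 hx).1

lemma nu_pos {α v : ℝ} (h0 : 0 ≤ α) (h1 : α < 1) (hv : 0 ≤ v) : 0 < nu α v := by
  have := mul_nonneg h0 hv
  unfold nu
  linarith

lemma nuStar_le_one {α x : ℝ} (h0 : 0 ≤ α) (h1 : α < 1) (hx : 0 ≤ x) : nuStar α x ≤ 1 := by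
  obtain ⟨hp, hq⟩ := nuStar_quadratic h0 h1 hx
  set y := nuStar α x
  by_contra! hy
  have h1' : 0 < 1 - α := by linarith
  have : (1 - α) * 1 < (1 - α) * ((1 + x) * y) := by
    apply mul_lt_mul_of_pos_left _ h1'
    nlinarith [mul_nonneg hx hp.le]
  have h2 : 0 ≤ α * x * y ^ 2 := by positivity
  linarith

/-- The quadratic with its denominators restored: `nuStar α` is a right inverse of `G`. Keeping the
posterior variance at this level takes SNR exactly `x` per slot. -/
lemma nuStar_eq {α x : ℝ} (h0 : 0 ≤ α) (h1 : α < 1) (hx : 0 ≤ x) :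
    1 / nuStar α x - 1 / nu α (nuStar α x) = x := by
  obtain ⟨hp, hq⟩ := nuStar_quadratic h0 h1 hx
  have hn := nu_pos h0 h1 hp.le
  rw [div_sub_div _ _ hp.ne' hn.ne', div_eq_iff (by positivity)]
  unfold nu
  linear_combination -hq

lemma nuHat_nu_nuStar {α x : ℝ} (h0 : 0 ≤ α) (h1 : α < 1) (hx : 0 ≤ x) :
    nuHat (nu α (nuStar α x)) x = nuStar α x := by
  obtain ⟨hp, hq⟩ := nuStar_quadratic h0 h1 hx
  have hn := nu_pos h0 h1 hp.le
  unfold nuHat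
  rw [div_eq_iff (by positivity)]
  unfold nu
  linear_combination -hq

/-! ### Bounds on the variances -/

lemma nu_mem {α v : ℝ} (h0 : 0 ≤ α) (h1 : α < 1) (hv1 : v ≤ 1) :
    v ≤ nu α v ∧ nu α v ≤ 1 := by
  unfold nu
  have := mul_nonneg h0 (sub_nonneg.2 hv1)
  constructor
  · nlinarith
  · linarith

lemma nuHat_mem {V Λ : ℝ} (hV : 0 < V) (hV1 : V ≤ 1) (hΛ : 0 ≤ Λ) :
    0 < nuHat V Λ ∧ nuHat V Λ ≤ 1 := by
  have := mul_nonneg hV.le hΛ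
  unfold nuHat
  refine ⟨by positivity, ?_⟩
  rw [div_le_one (by positivity)]
  linarith

lemma postVar_eq (α V0 : ℝ) (Λ : ℕ → ℝ) (k : ℕ) :
    postVar α V0 Λ k = nuHat (priorVar α V0 Λ k) (Λ k) := by
  cases k <;> rfl

lemma priorVar_mem {α : ℝ} (h0 : 0 ≤ α) (h1 : α < 1) {Λ : ℕ → ℝ} (hΛ : ∀ k, 0 ≤ Λ k) (k : ℕ) :
    0 < priorVar α 1 Λ k ∧ priorVar α 1 Λ k ≤ 1 := by
  induction k with
  | zero => simp [priorVar]
  | succ k ih =>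
    have h := nuHat_mem ih.1 ih.2 (hΛ k)
    rw [← postVar_eq] at h
    have h2 := nu_mem h0 h1 h.2
    exact ⟨h.1.trans_le h2.1, h2.2⟩

lemma postVar_mem {α : ℝ} (h0 : 0 ≤ α) (h1 : α < 1) {Λ : ℕ → ℝ} (hΛ : ∀ k, 0 ≤ Λ k) (k : ℕ) :
    0 < postVar α 1 Λ k ∧ postVar α 1 Λ k ≤ 1 := by
  rw [postVar_eq]
  have h := priorVar_mem h0 h1 hΛ k
  exact nuHat_mem h.1 h.2 (hΛ k)

lemma sampleMSE_mem {α : ℝ} (h0 : 0 ≤ α) (h1 : α < 1) {Λ : ℕ → ℝ} (hΛ : ∀ k, 0 ≤ Λ k) (T : ℕ) :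
    0 ≤ sampleMSE α 1 T Λ ∧ sampleMSE α 1 T Λ ≤ 1 := by
  unfold sampleMSE
  have hs : ∑ k ∈ Finset.range (T + 1), postVar α 1 Λ k ≤ (T : ℝ) + 1 := by
    refine (Finset.sum_le_sum fun k _ => (postVar_mem h0 h1 hΛ k).2).trans ?_
    simp
  have hs0 : 0 ≤ ∑ k ∈ Finset.range (T + 1), postVar α 1 Λ k :=
    Finset.sum_nonneg fun k _ => (postVar_mem h0 h1 hΛ k).1.le
  refine ⟨by positivity, ?_⟩
  rw [one_div, inv_mul_le_iff₀ (by positivity)]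
  linarith

/-! ### The pathwise lower bound -/

/-- The price of SNR: the inverse of `-G'` at `y`, where `G y = 1 / y - 1 / nu α y`. -/
def snrPrice (α y : ℝ) : ℝ := 1 / (1 / y ^ 2 - α / nu α y ^ 2)

/-- Since `nu α y ≥ y` and `α < 1`, the subtracted term `α / nu α y ^ 2` is smaller than `1 / y ^
2`. -/
lemma snrPrice_pos {α y : ℝ} (h0 : 0 ≤ α) (h1 : α < 1) (hy : 0 < y) (hy1 : y ≤ 1) :
    0 < snrPrice α y := by
  have h := nu_mem h0 h1 hy1
  have hn := nu_pos h0 h1 hy.le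
  unfold snrPrice
  apply one_div_pos.2
  rw [sub_pos, div_lt_div_iff₀ (by positivity) (by positivity), one_mul]
  have h3 : y ^ 2 ≤ nu α y ^ 2 := pow_le_pow_left₀ hy.le h.1 2
  have : 0 < y ^ 2 := by positivity
  nlinarith

lemma one_div_tangent {y z : ℝ} (hy : y ≠ 0) (hz : z ≠ 0) :
    1 / y - 1 / z + (y - z) / z ^ 2 = (y - z) ^ 2 / (y * z ^ 2) := by
  field_simp
  ring

/-- Convexity of `G y = 1 / y - 1 / nu α y`, in tangent form, scaled by the price at `z`. -/
lemma snrPrice_tangent {α y z : ℝ} (h0 : 0 ≤ α) (h1 : α < 1) (hy : 0 < y) (hy1 : y ≤ 1)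
    (hz : 0 < z) (hz1 : z ≤ 1) :
    z + snrPrice α z * (1 / z - 1 / nu α z) ≤ y + snrPrice α z * (1 / y - 1 / nu α y) := by
  have hμ := snrPrice_pos h0 h1 hz hz1
  have hny := nu_mem h0 h1 hy1
  have hnz := nu_mem h0 h1 hz1
  have hny0 := nu_pos h0 h1 hy.le
  have hnz0 := nu_pos h0 h1 hz.le
  have e1 := one_div_tangent hy.ne' hz.ne'
  have e2 := one_div_tangent hny0.ne' hnz0.ne'
  have hd : nu α y - nu α z = α * (y - z) := by unfold nu; ring
  rw [hd] at e2
  -- These are the tangent remainders of `1 / nu α y` and of `1 / y`. The first is no larger because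
  -- `α ≤ 1` and `nu α v ≥ v` for `v ≤ 1`; this is what makes the difference `G` convex.
  have h2 : (α * (y - z)) ^ 2 / (nu α y * nu α z ^ 2) ≤ (y - z) ^ 2 / (y * z ^ 2) := by
    apply div_le_div₀ (by positivity) _ (by positivity) _
    · rw [mul_pow]
      exact mul_le_of_le_one_left (by positivity) (pow_le_one₀ h0 h1.le)
    · exact mul_le_mul hny.1 (pow_le_pow_left₀ hz.le hnz.1 2) (by positivity) (by positivity)
  have h3 : 0 ≤ (1 / y - 1 / nu α y) - (1 / z - 1 / nu α z)
      + (1 / z ^ 2 - α / nu α z ^ 2) * (y - z) := by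
    have e3 : (1 / z ^ 2 - α / nu α z ^ 2) * (y - z)
        = (y - z) / z ^ 2 - α * (y - z) / nu α z ^ 2 := by ring
    rw [e3]
    linarith
  have h4 := mul_nonneg hμ.le h3
  have h5 : snrPrice α z * (1 / z ^ 2 - α / nu α z ^ 2) = 1 := by
    -- If the bracket vanished, the convention for division by zero would make the price 0.
    have h6 : 1 / z ^ 2 - α / nu α z ^ 2 ≠ 0 := by
      intro h
      rw [snrPrice, h, div_zero] at hμ
      exact hμ.false
    unfold snrPrice
    exact one_div_mul_cancel h6
  linear_combination h4 + (y - z) * h5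

/-- Information form of the Kalman update: a measurement adds its SNR to the precision. -/
lemma snr_eq_sub {α : ℝ} (h0 : 0 ≤ α) (h1 : α < 1) {Λ : ℕ → ℝ} (hΛ : ∀ k, 0 ≤ Λ k) (k : ℕ) :
    Λ k = 1 / postVar α 1 Λ k - 1 / priorVar α 1 Λ k := by
  have h := (priorVar_mem h0 h1 hΛ k).1
  have h2 := mul_nonneg h.le (hΛ k)
  rw [postVar_eq]
  unfold nuHat
  field_simp
  ring

/-- Lagrangian lower bound on the total MSE along every sequence of aggregate SNRs. -/
lemma sum_postVar_lower {α L : ℝ} (h0 : 0 ≤ α) (h1 : α < 1) (hL : 0 ≤ L) {Λ : ℕ → ℝ}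
    (hΛ : ∀ k, 0 ≤ Λ k) (n : ℕ) :
    snrPrice α (nuStar α L) * (1 / priorVar α 1 Λ n - 1) ≤
      ∑ k ∈ Finset.range n,
        ((postVar α 1 Λ k - nuStar α L) + snrPrice α (nuStar α L) * (Λ k - L)) := by
  induction n with
  | zero => simp [priorVar]
  | succ n ih =>
    rw [Finset.sum_range_succ]
    -- In the sum of the induction hypothesis and the tangent inequality for slot `n`, the SNR
    -- identity cancels `1 / priorVar n` and leaves `1 / nu α (postVar n)`, which is `1 / priorVar
    -- (n + 1)`.
    have hy := postVar_mem h0 h1 hΛ n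
    have ht := snrPrice_tangent h0 h1 hy.1 hy.2 (nuStar_pos h0 h1 hL) (nuStar_le_one h0 h1 hL)
    rw [nuStar_eq h0 h1 hL] at ht
    have hs := snr_eq_sub h0 h1 hΛ n
    have hp : priorVar α 1 Λ (n + 1) = nu α (postVar α 1 Λ n) := rfl
    rw [hp]
    linear_combination ih + ht + snrPrice α (nuStar α L) * (-hs)

/-- The boundary term `1 / priorVar - 1` is nonnegative and can be dropped. What remains is the
supporting line at `L` of the convex function `nuStar α`, whose slope there is minus the price. -/
lemma sampleMSE_lower {α L : ℝ} (h0 : 0 ≤ α) (h1 : α < 1) (hL : 0 ≤ L) {Λ : ℕ → ℝ}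
    (hΛ : ∀ k, 0 ≤ Λ k) (T : ℕ) :
    nuStar α L - snrPrice α (nuStar α L) *
        ((1 / ((T : ℝ) + 1)) * ∑ k ∈ Finset.range (T + 1), Λ k - L) ≤ sampleMSE α 1 T Λ := by
  have h := sum_postVar_lower h0 h1 hL hΛ (T + 1)
  have hμ := snrPrice_pos h0 h1 (nuStar_pos h0 h1 hL) (nuStar_le_one h0 h1 hL)
  have hp := priorVar_mem h0 h1 hΛ (T + 1)
  have h2 : 0 ≤ snrPrice α (nuStar α L) * (1 / priorVar α 1 Λ (T + 1) - 1) := by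
    apply mul_nonneg hμ.le
    rw [sub_nonneg]
    exact one_le_one_div hp.1 hp.2
  have h3 := h2.trans h
  simp only [Finset.sum_add_distrib, Finset.sum_sub_distrib, ← Finset.mul_sum, Finset.sum_const,
    Finset.card_range, nsmul_eq_mul] at h3
  push_cast at h3
  have hT : (0 : ℝ) < (T : ℝ) + 1 := by positivity
  have h4 := mul_nonneg (one_div_pos.2 hT).le h3
  unfold sampleMSE
  have h5 : 1 / ((T : ℝ) + 1) * ((T : ℝ) + 1) = 1 := one_div_mul_cancel hT.ne'
  linear_combination h4 + (-nuStar α L - snrPrice α (nuStar α L) * L) * h5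

/-! ### Constant aggregate SNR -/

/-- The difference equals `α * (y - z)` divided by two factors that are at least 1. -/
lemma nuHat_nu_contraction {α L y z : ℝ} (h0 : 0 ≤ α) (h1 : α < 1) (hL : 0 ≤ L) (hy : 0 ≤ y)
    (hz : 0 ≤ z) : |nuHat (nu α y) L - nuHat (nu α z) L| ≤ α * |y - z| := by
  have a := nu_pos h0 h1 hy
  have b := nu_pos h0 h1 hz
  have ha := mul_nonneg a.le hL
  have hb := mul_nonneg b.le hL
  have e : nuHat (nu α y) L - nuHat (nu α z) L
      = α * (y - z) / ((1 + nu α y * L) * (1 + nu α z * L)) := by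
    unfold nuHat
    rw [div_sub_div _ _ (by positivity) (by positivity)]
    congr 1
    unfold nu
    ring
  rw [e, abs_div, abs_mul, abs_of_nonneg h0]
  apply div_le_self (by positivity)
  rw [abs_of_pos (by positivity)]
  nlinarith

lemma tendsto_postVar_const {α L : ℝ} (h0 : 0 ≤ α) (h1 : α < 1) (hL : 0 ≤ L) :
    Tendsto (postVar α 1 fun _ => L) atTop (𝓝 (nuStar α L)) := by
  have hb : ∀ k, |postVar α 1 (fun _ => L) k - nuStar α L| ≤
      α ^ k * |postVar α 1 (fun _ => L) 0 - nuStar α L| := by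
    intro k
    induction k with
    | zero => simp
    | succ k ih =>
      have hc := nuHat_nu_contraction h0 h1 hL
        (postVar_mem h0 h1 (Λ := fun _ => L) (fun _ => hL) k).1.le (nuStar_pos h0 h1 hL).le
      rw [nuHat_nu_nuStar h0 h1 hL] at hc
      refine hc.trans ?_
      rw [pow_succ', mul_assoc]
      exact mul_le_mul_of_nonneg_left ih h0
  rw [tendsto_iff_norm_sub_tendsto_zero]
  refine squeeze_zero (fun _ => norm_nonneg _) hb ?_
  simpa using (tendsto_pow_atTop_nhds_zero_of_lt_one h0 h1).mul_const
    |postVar α 1 (fun _ => L) 0 - nuStar α L|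

lemma tendsto_sampleMSE_const {α L : ℝ} (h0 : 0 ≤ α) (h1 : α < 1) (hL : 0 ≤ L) :
    Tendsto (fun T => sampleMSE α 1 T fun _ => L) atTop (𝓝 (nuStar α L)) := by
  have h := ((tendsto_postVar_const h0 h1 hL).cesaro).comp (tendsto_add_atTop_nat 1)
  refine h.congr fun T => ?_
  simp [sampleMSE]

variable {W : Network}

/-! ### Costs and aggregate SNR of an instruction -/

lemma cost_nonneg (hW : W.Admissible) (a : Action W.B) : 0 ≤ cost W a := by
  have := hW.cTX_pos
  have := hW.phi_pos
  unfold cost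
  split_ifs <;> positivity

lemma measurable_cost (W : Network) : Measurable (cost W) := by
  have h1 : Measurable (fun a : Action W.B => a.active) := by
    unfold Action.active
    fun_prop
  refine Measurable.ite (h1 (measurableSet_singleton true)) ?_ measurable_const
  unfold Action.snr
  fun_prop

lemma localSNR_nonneg {SA S : ℝ} (hSA : 0 < SA) (hS : 0 ≤ S) : 0 ≤ localSNR SA 1 S := by
  unfold localSNR
  positivity

lemma aggSNR_nonneg (hW : W.Admissible) (D : Instruction W) : 0 ≤ aggSNR D := by
  refine Finset.sum_nonneg fun n _ => ?_
  split_ifs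
  · exact localSNR_nonneg hW.SA_pos NNReal.zero_le_coe
  · exact le_rfl

lemma aggSNR_le (hW : W.Admissible) (D : Instruction W) : aggSNR D ≤ W.NS * W.SA := by
  have h : ∀ n ∈ Finset.univ,
      (if success D n = true then localSNR W.SA 1 ((D n).snr : ℝ) else 0) ≤ W.SA := by
    intro n _
    have hSA := hW.SA_pos
    split_ifs
    · have : (0 : ℝ) ≤ (D n).snr := NNReal.zero_le_coe
      unfold localSNR
      rw [one_pow, one_mul, div_le_iff₀ (by positivity)]
      nlinarith
    · exact hSA.le
  simpa [aggSNR] using Finset.sum_le_sum h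

lemma integrable_aggSNR (hW : W.Admissible) (μ : Measure (Instruction W)) [IsFiniteMeasure μ] :
    Integrable aggSNR μ := by
  refine Integrable.of_bound (measurable_aggSNR W).aestronglyMeasurable (W.NS * W.SA) ?_
  refine ae_of_all _ fun D => ?_
  rw [Real.norm_of_nonneg (aggSNR_nonneg hW D)]
  exact aggSNR_le hW D

lemma success_iff (D : Instruction W) (n : Fin W.NS) :
    success D n = true ↔ (D n).active = true ∧
      ∀ m, m ≠ n → (D m).active = true → (D m).channel ≠ (D n).channel := by
  simp [success]

/-- At most one node per channel succeeds. -/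
lemma card_success_le (D : Instruction W) :
    (Finset.univ.filter fun n => success D n = true).card ≤ W.B := by
  -- Channel 0 is removed because a successful node is active; on successful nodes the channel map
  -- is injective, as success forbids sharing.
  have hc : (Finset.univ.erase (0 : Fin (W.B + 1))).card = W.B := by simp
  rw [← hc]
  refine Finset.card_le_card_of_injOn (fun n => (D n).channel) ?_ ?_
  · intro n hn
    have hn' := ((success_iff D n).1 (by simpa using hn)).1
    simp only [Finset.coe_erase, Finset.coe_univ, Set.mem_sdiff, Set.mem_univ, true_and,
      Set.mem_singleton_iff]
    exact (D n).2.2 hn'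
  · intro n hn m hm hnm
    by_contra hne
    have hn' := (success_iff D n).1 (by simpa using hn)
    have hm' := (success_iff D m).1 (by simpa using hm)
    exact hm'.2 n hne hn'.1 hnm

/-- Concavity in `s`: the gap to the tangent at `S` is a square over a positive denominator. -/
lemma localSNR_tangent {SA S s : ℝ} (hSA : 0 < SA) (hS : 0 ≤ S) (hs : 0 ≤ s) :
    localSNR SA 1 s ≤ SA * S / (SA + S) + SA ^ 2 / (SA + S) ^ 2 * (s - S) := by
  have e : SA * S / (SA + S) + SA ^ 2 / (SA + S) ^ 2 * (s - S) - localSNR SA 1 s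
      = SA ^ 2 * (s - S) ^ 2 / ((SA + S) ^ 2 * (SA + s)) := by
    unfold localSNR
    field_simp
    ring
  have : 0 ≤ SA ^ 2 * (s - S) ^ 2 / ((SA + S) ^ 2 * (SA + s)) := by positivity
  linarith

/-- The aggregate SNR is bounded by an affine function of the total cost, which takes the value
`t * (SA * S / (SA + S))` at the cost of `t` active nodes with local measurement SNR `S`. -/
lemma aggSNR_affine_bound (hW : W.Admissible) {S ε : ℝ} {t : ℕ} (hS : 0 ≤ S)
    (hε : ε = t * (W.cTX + W.phi * S)) (hle : W.SA * W.cTX ≤ W.phi * S ^ 2)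
    (hor : W.SA * W.cTX = W.phi * S ^ 2 ∨ t = W.B) :
    ∃ l : ℝ, 0 ≤ l ∧ ∀ D : Instruction W,
      aggSNR D ≤ l * (∑ n, cost W (D n) - ε) + t * (W.SA * S / (W.SA + S)) := by
  have hSA := hW.SA_pos
  have hφ := hW.phi_pos
  have hc := hW.cTX_pos
  -- `l` is the slope of the tangent at `S` per unit of cost, the multiplier of the total budget.
  set l := W.SA ^ 2 / (W.SA + S) ^ 2 / W.phi with hl
  have hl0 : 0 ≤ l := by positivity
  -- `b` is the SNR of a success left after paying its cost at rate `l`, the multiplier of the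
  -- channel constraint. Its sign is that of `φ S² - S_A c_TX`.
  set b := W.SA * S / (W.SA + S) - l * (W.cTX + W.phi * S) with hb
  have hb' : b = W.SA * (W.phi * S ^ 2 - W.SA * W.cTX) / (W.phi * (W.SA + S) ^ 2) := by
    rw [hb, hl]
    field_simp
    ring
  have hb0 : 0 ≤ b := by
    rw [hb']
    have := sub_nonneg.2 hle
    positivity
  -- Complementary slackness: either channels are free (`b = 0`) or all `B` of them are in use.
  have hbt : b * W.B = b * t := by
    rcases hor with h | h
    · rw [hb', h]
      simp
    · rw [h]
  refine ⟨l, hl0, fun D => ?_⟩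
  have h1 : ∀ n ∈ Finset.univ,
      (if success D n = true then localSNR W.SA 1 ((D n).snr : ℝ) else 0)
        ≤ l * cost W (D n) + b * (if success D n = true then 1 else 0) := by
    intro n _
    split_ifs with h
    · have h2 := localSNR_tangent hSA hS (s := (D n).snr) NNReal.zero_le_coe
      have h3 : cost W (D n) = W.cTX + W.phi * (D n).snr := by
        simp [cost, ((success_iff D n).1 h).1]
      have h4 : l * W.phi = W.SA ^ 2 / (W.SA + S) ^ 2 := by
        rw [hl]
        field_simp
      rw [← h4] at h2
      rw [h3]
      linear_combination h2 + hb
    · have := mul_nonneg hl0 (cost_nonneg hW (D n))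
      simpa using this
  have h5 := Finset.sum_le_sum h1
  rw [Finset.sum_add_distrib, ← Finset.mul_sum, ← Finset.mul_sum, Finset.sum_boole] at h5
  have h6 : ((Finset.univ.filter fun n => success D n = true).card : ℝ) ≤ W.B := by
    exact_mod_cast card_success_le D
  have h7 := mul_le_mul_of_nonneg_left h6 hb0
  have h8 : aggSNR D ≤ l * ∑ n, cost W (D n) + b * t := by
    unfold aggSNR
    linarith
  rw [hε]
  linear_combination h8 + t * hb

/-! ### The uniformly permuted schedule -/

lemma schedule_active {t : ℕ} (ht : t ≤ W.B) (S : ℝ≥0) (σ : Equiv.Perm (Fin W.NS))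
    (n : Fin W.NS) : (schedule ht S σ n).active = true ↔ (σ n : ℕ) < t := by
  unfold schedule
  split_ifs with h <;> simp [Action.active, activate, idle, h]

lemma schedule_success {t : ℕ} (ht : t ≤ W.B) (S : ℝ≥0) (σ : Equiv.Perm (Fin W.NS))
    (n : Fin W.NS) : success (schedule ht S σ) n = true ↔ (σ n : ℕ) < t := by
  rw [success_iff, schedule_active]
  refine and_iff_left_of_imp fun h m hm hma hch => ?_
  rw [schedule_active] at hma
  simp only [schedule, h, hma, dite_true, Action.channel, activate, Fin.ext_iff] at hch
  exact hm (σ.injective (Fin.ext (by omega)))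

lemma schedule_snr {t : ℕ} (ht : t ≤ W.B) (S : ℝ≥0) (σ : Equiv.Perm (Fin W.NS))
    (n : Fin W.NS) (h : (σ n : ℕ) < t) : (schedule ht S σ n).snr = S := by
  simp [schedule, h, Action.snr, activate]

lemma card_perm_lt (hW : W.Admissible) {t : ℕ} (ht : t ≤ W.B) (σ : Equiv.Perm (Fin W.NS)) :
    (Finset.univ.filter fun n => (σ n : ℕ) < t).card = t := by
  have h : (Finset.univ.filter fun n => (σ n : ℕ) < t).card
      = (Finset.univ.filter fun n : Fin W.NS => (n : ℕ) < t).card := by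
    refine Finset.card_equiv σ fun n => ?_
    simp
  rw [h, Fin.card_filter_val_lt]
  exact min_eq_right (ht.trans hW.B_le_NS)

lemma aggSNR_schedule (hW : W.Admissible) {t : ℕ} (ht : t ≤ W.B) (S : ℝ≥0)
    (σ : Equiv.Perm (Fin W.NS)) :
    aggSNR (schedule ht S σ) = t * (W.SA * S / (W.SA + S)) := by
  have h : ∀ n ∈ Finset.univ, (if success (schedule ht S σ) n = true then
      localSNR W.SA 1 ((schedule ht S σ n).snr : ℝ) else 0)
      = (if (σ n : ℕ) < t then 1 else 0) * (W.SA * S / (W.SA + S)) := by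
    intro n _
    by_cases h : (σ n : ℕ) < t
    · rw [if_pos ((schedule_success ht S σ n).2 h), if_pos h, schedule_snr ht S σ n h, localSNR]
      ring
    · rw [if_neg (fun h' => h ((schedule_success ht S σ n).1 h')), if_neg h, zero_mul]
  unfold aggSNR
  rw [Finset.sum_congr rfl h, ← Finset.sum_mul, Finset.sum_boole, card_perm_lt hW ht]

lemma ae_uniformSchedule {t : ℕ} (ht : t ≤ W.B) (S : ℝ≥0) {p : Instruction W → Prop}
    (hm : MeasurableSet {D | p D}) (h : ∀ σ, p (schedule ht S σ)) :
    ∀ᵐ D ∂(uniformSchedule ht S), p D := by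
  rw [ae_iff, ← Set.compl_ofPred]
  simp only [uniformSchedule, Measure.coe_finsetSum, Finset.sum_apply, Measure.smul_apply,
    smul_eq_mul]
  refine Finset.sum_eq_zero fun σ _ => ?_
  rw [Measure.dirac_apply' _ hm.compl]
  simp [h σ]

lemma ae_aggSNR_uniformSchedule (hW : W.Admissible) {t : ℕ} (ht : t ≤ W.B) (S : ℝ≥0) :
    ∀ᵐ D ∂(uniformSchedule (W := W) ht S), aggSNR D = t * (W.SA * S / (W.SA + S)) :=
  ae_uniformSchedule ht S (measurable_aggSNR W (measurableSet_singleton _))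
    (aggSNR_schedule hW ht S)

lemma integral_aggSNR_uniformSchedule (hW : W.Admissible) {t : ℕ} (ht : t ≤ W.B) (S : ℝ≥0) :
    ∫ D, aggSNR D ∂(uniformSchedule (W := W) ht S) = t * (W.SA * S / (W.SA + S)) := by
  rw [integral_congr_ae (ae_aggSNR_uniformSchedule hW ht S)]
  simp

/-- Double counting of the pairs (node, permutation) in which the node is active. Composing with a
transposition shows that the count is the same for every node. -/
lemma card_perm_apply_lt (hW : W.Admissible) {t : ℕ} (ht : t ≤ W.B) (n : Fin W.NS) :
    W.NS * (Finset.univ.filter fun σ : Equiv.Perm (Fin W.NS) => (σ n : ℕ) < t).card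
      = t * Fintype.card (Equiv.Perm (Fin W.NS)) := by
  have hsymm : ∀ m : Fin W.NS,
      (Finset.univ.filter fun σ : Equiv.Perm (Fin W.NS) => (σ m : ℕ) < t).card
        = (Finset.univ.filter fun σ : Equiv.Perm (Fin W.NS) => (σ n : ℕ) < t).card := by
    intro m
    refine Finset.card_equiv (Equiv.mulRight (Equiv.swap m n)) fun σ => ?_
    simp
  calc W.NS * (Finset.univ.filter fun σ : Equiv.Perm (Fin W.NS) => (σ n : ℕ) < t).card
      = ∑ m : Fin W.NS,
          (Finset.univ.filter fun σ : Equiv.Perm (Fin W.NS) => (σ m : ℕ) < t).card := by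
        simp [hsymm]
    _ = ∑ σ : Equiv.Perm (Fin W.NS), (Finset.univ.filter fun m => (σ m : ℕ) < t).card := by
        simp only [Finset.card_filter]
        exact Finset.sum_comm
    _ = t * Fintype.card (Equiv.Perm (Fin W.NS)) := by
        simp [card_perm_lt hW ht, mul_comm]

/-- By symmetry each node is active with probability `t / N_S`. -/
lemma lintegral_cost_uniformSchedule (hW : W.Admissible) {t : ℕ} (ht : t ≤ W.B) (S : ℝ≥0)
    (n : Fin W.NS) :
    ∫⁻ D, ENNReal.ofReal (cost W (D n)) ∂(uniformSchedule ht S)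
      = ENNReal.ofReal (t * (W.cTX + W.phi * S) / W.NS) := by
  have hm : Measurable fun D : Instruction W => ENNReal.ofReal (cost W (D n)) :=
    ((measurable_cost W).comp (measurable_pi_apply n)).ennreal_ofReal
  have hc := hW.cTX_pos
  have hφ := hW.phi_pos
  have hN : (0 : ℝ) < W.NS := by exact_mod_cast hW.B_pos.trans hW.B_le_NS
  have hcost : ∀ σ : Equiv.Perm (Fin W.NS), cost W (schedule ht S σ n)
      = (if (σ n : ℕ) < t then 1 else 0) * (W.cTX + W.phi * S) := by
    intro σ
    unfold cost
    by_cases h : (σ n : ℕ) < t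
    · rw [if_pos ((schedule_active ht S σ n).2 h), if_pos h, schedule_snr ht S σ n h, one_mul]
    · rw [if_neg (fun h' => h ((schedule_active ht S σ n).1 h')), if_neg h, zero_mul]
  have hcard := card_perm_apply_lt hW ht n
  set P := Fintype.card (Equiv.Perm (Fin W.NS)) with hP
  have hP0 : (0 : ℝ) < P := by exact_mod_cast Fintype.card_pos
  have hinv : (P : ℝ≥0∞)⁻¹ = ENNReal.ofReal (P : ℝ)⁻¹ := by
    rw [ENNReal.ofReal_inv_of_pos hP0, ENNReal.ofReal_natCast]
  unfold uniformSchedule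
  simp only [lintegral_finsetSum_measure, lintegral_smul_measure, lintegral_dirac' _ hm,
    smul_eq_mul, ← hP, hinv]
  rw [← Finset.mul_sum, ← ENNReal.ofReal_sum_of_nonneg fun σ _ => cost_nonneg hW _,
    ← ENNReal.ofReal_mul (by positivity)]
  congr 1
  rw [Finset.sum_congr rfl fun σ _ => hcost σ, ← Finset.sum_mul, Finset.sum_boole]
  have hcard' : (W.NS : ℝ) *
      (Finset.univ.filter fun σ : Equiv.Perm (Fin W.NS) => (σ n : ℕ) < t).card = t * P := by
    exact_mod_cast hcard
  field_simp
  linear_combination hcard'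

/-! ### Expectations under the law of a policy -/

instance (δ : Policy W) : IsProbabilityMeasure (law δ) := by
  have := δ.isMarkov 0
  unfold law
  infer_instance

/-- Costs are unbounded, so their integrability has to be drawn from the extended-valued budget
itself. -/
lemma integrable_and_integral_le_of_lintegral_le {Ω : Type*} [MeasurableSpace Ω] {μ : Measure Ω}
    {f : Ω → ℝ} (hf : Measurable f) (h0 : ∀ x, 0 ≤ f x) {c : ℝ} (hc : 0 ≤ c)
    (h : ∫⁻ x, ENNReal.ofReal (f x) ∂μ ≤ ENNReal.ofReal c) :
    Integrable f μ ∧ ∫ x, f x ∂μ ≤ c := by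
  refine ⟨⟨hf.aestronglyMeasurable, ?_⟩, ?_⟩
  · rw [hasFiniteIntegral_iff_ofReal (ae_of_all _ h0)]
    exact h.trans_lt ENNReal.ofReal_lt_top
  · rw [integral_eq_lintegral_of_nonneg_ae (ae_of_all _ h0) hf.aestronglyMeasurable]
    exact ENNReal.toReal_le_of_le_ofReal hc h

lemma measurable_sampleMSE (α : ℝ) (T : ℕ) :
    Measurable fun D : ℕ → Instruction W => sampleMSE α 1 T fun k => aggSNR (D k) := by
  have hΛ : ∀ k, Measurable fun D : ℕ → Instruction W => aggSNR (D k) := fun k =>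
    (measurable_aggSNR W).comp (measurable_pi_apply k)
  have hp : ∀ k, Measurable fun D : ℕ → Instruction W =>
      postVar α 1 (fun k => aggSNR (D k)) k := by
    intro k
    induction k with
    | zero =>
      simp only [postVar, nuHat]
      have := hΛ 0
      fun_prop
    | succ k ih =>
      simp only [postVar, nuHat, nu]
      have := hΛ (k + 1)
      fun_prop
  unfold sampleMSE
  exact (Finset.measurable_sum _ fun k _ => hp k).const_mul _

lemma integrable_sampleMSE (hW : W.Admissible) (δ : Policy W) (T : ℕ) :
    Integrable (fun D : ℕ → Instruction W => sampleMSE W.alpha 1 T fun k => aggSNR (D k))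
      (law δ) := by
  refine Integrable.of_bound (measurable_sampleMSE W.alpha T).aestronglyMeasurable 1 ?_
  refine ae_of_all _ fun D => ?_
  have h := sampleMSE_mem hW.alpha_nonneg hW.alpha_lt_one (fun k => aggSNR_nonneg hW (D k)) T
  rw [Real.norm_of_nonneg h.1]
  exact h.2

lemma avgMSE_mem (hW : W.Admissible) (δ : Policy W) (T : ℕ) :
    0 ≤ avgMSE δ T ∧ avgMSE δ T ≤ 1 := by
  have h := fun D : ℕ → Instruction W =>
    sampleMSE_mem hW.alpha_nonneg hW.alpha_lt_one (fun k => aggSNR_nonneg hW (D k)) T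
  refine ⟨integral_nonneg fun D => (h D).1, ?_⟩
  simpa [avgMSE] using
    integral_mono (integrable_sampleMSE hW δ T) (integrable_const 1) fun D => (h D).2

lemma measurable_sampleCost (n : Fin W.NS) (T : ℕ) :
    Measurable fun D : ℕ → Instruction W =>
      (1 / ((T : ℝ) + 1)) * ∑ k ∈ Finset.range (T + 1), cost W (D k n) :=
  (Finset.measurable_sum _ fun k _ => (measurable_cost W).comp
    ((measurable_pi_apply n).comp (measurable_pi_apply k))).const_mul _

/-! ### The lower bound for feasible policies -/

/-- The two multipliers compose: `snrPrice` converts SNR into MSE and `l` converts cost into SNR.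
The bound is pathwise and involves no policy. -/
lemma sampleMSE_lower_of_affine (hW : W.Admissible) {L l ε : ℝ} (hL : 0 ≤ L)
    (h : ∀ D : Instruction W, aggSNR D ≤ l * (∑ n, cost W (D n) - ε) + L)
    (D : ℕ → Instruction W) (T : ℕ) :
    nuStar W.alpha L - snrPrice W.alpha (nuStar W.alpha L) * l *
        (∑ n, (1 / ((T : ℝ) + 1)) * ∑ k ∈ Finset.range (T + 1), cost W (D k n) - ε)
      ≤ sampleMSE W.alpha 1 T fun k => aggSNR (D k) := by
  have h0 := hW.alpha_nonneg
  have h1 := hW.alpha_lt_one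
  refine le_trans ?_ (sampleMSE_lower h0 h1 hL (fun k => aggSNR_nonneg hW (D k)) T)
  have hμ := snrPrice_pos h0 h1 (nuStar_pos h0 h1 hL) (nuStar_le_one h0 h1 hL)
  have hs := Finset.sum_le_sum fun k (_ : k ∈ Finset.range (T + 1)) => h (D k)
  rw [Finset.sum_add_distrib, ← Finset.mul_sum, Finset.sum_sub_distrib, Finset.sum_comm] at hs
  simp only [Finset.sum_const, Finset.card_range, nsmul_eq_mul] at hs
  push_cast at hs
  rw [← Finset.mul_sum]
  have hT : (0 : ℝ) < (T : ℝ) + 1 := by positivity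
  have h5 : 1 / ((T : ℝ) + 1) * ((T : ℝ) + 1) = 1 := one_div_mul_cancel hT.ne'
  have hs2 := mul_le_mul_of_nonneg_left hs (one_div_pos.2 hT).le
  have hs3 : 1 / ((T : ℝ) + 1) * ∑ k ∈ Finset.range (T + 1), aggSNR (D k) - L
      ≤ l * (1 / ((T : ℝ) + 1) * ∑ n, ∑ k ∈ Finset.range (T + 1), cost W (D k n) - ε) := by
    linear_combination hs2 + (L - l * ε) * h5
  linear_combination mul_le_mul_of_nonneg_left hs3 hμ.le

lemma avgMSE_lower (hW : W.Admissible) {L l ε η : ℝ} (hL : 0 ≤ L) (hl : 0 ≤ l)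
    (hε : 0 ≤ ε + η) (h : ∀ D : Instruction W, aggSNR D ≤ l * (∑ n, cost W (D n) - ε) + L)
    (δ : Policy W) (T : ℕ) (hc : ∀ n, avgCost δ n T ≤ ENNReal.ofReal ((ε + η) / W.NS)) :
    nuStar W.alpha L - snrPrice W.alpha (nuStar W.alpha L) * l * η ≤ avgMSE δ T := by
  have h0 := hW.alpha_nonneg
  have h1 := hW.alpha_lt_one
  have hμ := snrPrice_pos h0 h1 (nuStar_pos h0 h1 hL) (nuStar_le_one h0 h1 hL)
  have hN : (0 : ℝ) < W.NS := by exact_mod_cast hW.B_pos.trans hW.B_le_NS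
  have hi := fun n => integrable_and_integral_le_of_lintegral_le (μ := law δ)
    (measurable_sampleCost n T)
    (fun D => mul_nonneg (by positivity) (Finset.sum_nonneg fun k _ => cost_nonneg hW (D k n)))
    (div_nonneg hε hN.le) (hc n)
  have hint := integrable_finsetSum Finset.univ fun n _ => (hi n).1
  have hsum : ∫ D, ∑ n, (1 / ((T : ℝ) + 1)) * ∑ k ∈ Finset.range (T + 1), cost W (D k n) ∂(law δ)
      ≤ ε + η := by
    rw [integral_finsetSum _ fun n _ => (hi n).1]
    refine (Finset.sum_le_sum fun n _ => (hi n).2).trans_eq ?_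
    simp only [Finset.sum_const, Finset.card_univ, Fintype.card_fin, nsmul_eq_mul]
    field_simp
  have hsub : Integrable (fun D : ℕ → Instruction W =>
      ∑ n, (1 / ((T : ℝ) + 1)) * ∑ k ∈ Finset.range (T + 1), cost W (D k n) - ε) (law δ) :=
    hint.sub (integrable_const ε)
  have hmono := integral_mono
    ((integrable_const (nuStar W.alpha L)).sub (hsub.const_mul
      (snrPrice W.alpha (nuStar W.alpha L) * l)))
    (integrable_sampleMSE hW δ T) fun D => sampleMSE_lower_of_affine hW hL h D T
  refine le_trans ?_ hmono
  simp only [Pi.sub_apply]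
  rw [integral_sub (integrable_const _)
    (hsub.const_mul _), integral_const_mul,
    integral_sub hint (integrable_const ε)]
  simp only [integral_const, probReal_univ, one_smul]
  have hml := mul_nonneg hμ.le hl
  linear_combination mul_le_mul_of_nonneg_left hsum hml

lemma isBoundedUnder_avgMSE (hW : W.Admissible) (δ : Policy W) :
    IsBoundedUnder (· ≤ ·) atTop (avgMSE δ) ∧ IsBoundedUnder (· ≥ ·) atTop (avgMSE δ) :=
  ⟨isBoundedUnder_of ⟨1, fun T => (avgMSE_mem hW δ T).2⟩,
    isBoundedUnder_of ⟨0, fun T => (avgMSE_mem hW δ T).1⟩⟩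

lemma nuStar_le_liminf_avgMSE (hW : W.Admissible) {L l ε : ℝ} (hL : 0 ≤ L) (hl : 0 ≤ l)
    (hε : 0 ≤ ε) (h : ∀ D : Instruction W, aggSNR D ≤ l * (∑ n, cost W (D n) - ε) + L)
    (δ : Policy W) (hδ : IsFeasible ε δ) :
    nuStar W.alpha L ≤ liminf (avgMSE δ) atTop := by
  have h0 := hW.alpha_nonneg
  have h1 := hW.alpha_lt_one
  have hμ := snrPrice_pos h0 h1 (nuStar_pos h0 h1 hL) (nuStar_le_one h0 h1 hL)
  have hN : (0 : ℝ) < W.NS := by exact_mod_cast hW.B_pos.trans hW.B_le_NS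
  -- Feasibility constrains only the limsup, so at large finite horizons the budgets hold up to an
  -- arbitrary slack `η > 0`, which is sent to 0 at the end.
  have key : ∀ η > 0, nuStar W.alpha L - snrPrice W.alpha (nuStar W.alpha L) * l * η
      ≤ liminf (avgMSE δ) atTop := by
    intro η hη
    refine le_liminf_of_le (isBoundedUnder_avgMSE hW δ).1.isCoboundedUnder_ge ?_
    have hev : ∀ᶠ T in atTop, ∀ n, avgCost δ n T < ENNReal.ofReal ((ε + η) / W.NS) := by
      rw [eventually_all]
      intro n
      refine eventually_lt_of_limsup_lt ((hδ n).trans_lt ?_)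
      rw [ENNReal.ofReal_lt_ofReal_iff (by positivity)]
      gcongr
      linarith
    filter_upwards [hev] with T hT
    exact avgMSE_lower hW hL hl (by positivity) h δ T fun n => (hT n).le
  have hlim : Tendsto (fun η : ℝ =>
      nuStar W.alpha L - snrPrice W.alpha (nuStar W.alpha L) * l * η) (𝓝[>] 0)
      (𝓝 (nuStar W.alpha L)) := by
    have hcont : Continuous fun η : ℝ =>
      nuStar W.alpha L - snrPrice W.alpha (nuStar W.alpha L) * l * η := by fun_prop
    simpa using (hcont.tendsto 0).mono_left nhdsWithin_le_nhds
  exact le_of_tendsto hlim (eventually_nhdsWithin_of_forall fun η hη => key η hη)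

/-- The affine bound averaged over a single slot; the node budgets enter only through their sum, at
most `ε`. -/
lemma integral_aggSNR_le (hW : W.Admissible) {L l ε : ℝ} (hl : 0 ≤ l) (hε : 0 ≤ ε)
    (h : ∀ D : Instruction W, aggSNR D ≤ l * (∑ n, cost W (D n) - ε) + L)
    (μ : Measure (Instruction W)) [IsProbabilityMeasure μ] (hμ : SlotFeasible ε μ) :
    ∫ D, aggSNR D ∂μ ≤ L := by
  have hN : (0 : ℝ) < W.NS := by exact_mod_cast hW.B_pos.trans hW.B_le_NS
  have hi := fun n => integrable_and_integral_le_of_lintegral_le (μ := μ)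
    ((measurable_cost W).comp (measurable_pi_apply n)) (fun D => cost_nonneg hW (D n))
    (div_nonneg hε hN.le) (hμ n)
  simp only [Function.comp_def] at hi
  have hint := integrable_finsetSum Finset.univ fun n _ => (hi n).1
  have hsum : ∫ D, ∑ n, cost W (D n) ∂μ ≤ ε := by
    rw [integral_finsetSum _ fun n _ => (hi n).1]
    refine (Finset.sum_le_sum fun n _ => (hi n).2).trans_eq ?_
    simp only [Finset.sum_const, Finset.card_univ, Fintype.card_fin, nsmul_eq_mul]
    field_simp
  have hsub : Integrable (fun D : Instruction W => ∑ n, cost W (D n) - ε) μ :=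
    hint.sub (integrable_const ε)
  have hmono := integral_mono (integrable_aggSNR hW μ)
    ((hsub.const_mul l).add (integrable_const L)) h
  refine hmono.trans ?_
  simp only [Pi.add_apply]
  rw [integral_add (hsub.const_mul l) (integrable_const L),
    integral_const_mul, integral_sub hint (integrable_const ε)]
  simp only [integral_const, probReal_univ, one_smul]
  linear_combination mul_le_mul_of_nonneg_left hsum hl

/-! ### Non-adaptive policies -/

lemma trajMeasure_map_zero {X : ℕ → Type*} [∀ n, MeasurableSpace (X n)] (μ₀ : Measure (X 0))
    (κ : (n : ℕ) → Kernel ((i : Finset.Iic n) → X i) (X (n + 1))) [∀ n, IsMarkovKernel (κ n)] :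
    (Kernel.trajMeasure μ₀ κ).map (fun x => x 0) = μ₀ := by
  have e : (fun x : (n : ℕ) → X n => x 0)
      = (fun y : (i : Finset.Iic 0) → X i => y ⟨0, by simp⟩) ∘ Preorder.frestrictLe 0 := rfl
  rw [e, ← Measure.map_map (by fun_prop) (by fun_prop), Kernel.trajMeasure,
    Measure.map_comp _ _ (by fun_prop), Kernel.traj_map_frestrictLe, Kernel.partialTraj_self,
    Measure.id_comp]
  exact (Measure.map_map (by fun_prop) (by fun_prop)).trans Measure.map_id

/-- The one-slot marginals suffice for the constant policy: an almost sure property of every slot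
passes to a countable intersection, and expected costs add. Independence between slots plays no
role. -/
lemma trajMeasure_map_succ {X : ℕ → Type*} [∀ n, MeasurableSpace (X n)] (μ₀ : Measure (X 0))
    [IsProbabilityMeasure μ₀] (κ : (n : ℕ) → Kernel ((i : Finset.Iic n) → X i) (X (n + 1)))
    [∀ n, IsMarkovKernel (κ n)] (n : ℕ) :
    (Kernel.trajMeasure μ₀ κ).map (fun x => x (n + 1))
      = κ n ∘ₘ (Kernel.trajMeasure μ₀ κ).map (Preorder.frestrictLe n) := by
  rw [← Measure.snd_compProd, Kernel.map_frestrictLe_trajMeasure_compProd_eq_map_trajMeasure,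
    Measure.snd, Measure.map_map (by fun_prop) (by fun_prop)]
  rfl

/-- In every slot, the instruction of the constant policy follows the uniform schedule. -/
lemma law_constantPolicy_map {t : ℕ} (ht : t ≤ W.B) (S : ℝ≥0) (k : ℕ) :
    (law (constantPolicy W ht S)).map (fun D => D k) = uniformSchedule ht S := by
  have := (constantPolicy W ht S).isMarkov 0
  cases k with
  | zero => exact trajMeasure_map_zero (X := fun _ => Instruction W) _ _
  | succ n =>
    refine (trajMeasure_map_succ (X := fun _ => Instruction W) _ _ n).trans ?_
    have hstep : stepKernel (constantPolicy W ht S) n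
        = Kernel.const _ (uniformSchedule ht S) := rfl
    rw [hstep, Measure.const_comp]
    have : IsProbabilityMeasure ((Kernel.trajMeasure (X := fun _ => Instruction W)
        ((constantPolicy W ht S).kernel 0 1) (stepKernel (constantPolicy W ht S))).map
        (Preorder.frestrictLe n)) :=
      Measure.isProbabilityMeasure_map (by fun_prop)
    rw [measure_univ, one_smul]

lemma ae_law_constantPolicy (hW : W.Admissible) {t : ℕ} (ht : t ≤ W.B) (S : ℝ≥0) :
    ∀ᵐ D ∂(law (constantPolicy W ht S)), ∀ k, aggSNR (D k) = t * (W.SA * S / (W.SA + S)) := by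
  rw [ae_all_iff]
  intro k
  have h := ae_aggSNR_uniformSchedule hW ht S
  rw [← law_constantPolicy_map ht S k] at h
  exact ae_of_ae_map (measurable_pi_apply k).aemeasurable h

lemma avgMSE_constantPolicy (hW : W.Admissible) {t : ℕ} (ht : t ≤ W.B) (S : ℝ≥0) (T : ℕ) :
    avgMSE (constantPolicy W ht S) T
      = sampleMSE W.alpha 1 T fun _ => t * (W.SA * S / (W.SA + S)) := by
  have h : ∀ᵐ D ∂(law (constantPolicy W ht S)),
      sampleMSE W.alpha 1 T (fun k => aggSNR (D k))
        = sampleMSE W.alpha 1 T fun _ => t * (W.SA * S / (W.SA + S)) := by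
    filter_upwards [ae_law_constantPolicy hW ht S] with D hD
    simp only [hD]
  rw [avgMSE, integral_congr_ae h]
  simp

lemma avgCost_constantPolicy (hW : W.Admissible) {t : ℕ} (ht : t ≤ W.B) (S : ℝ≥0)
    (n : Fin W.NS) (T : ℕ) :
    avgCost (constantPolicy W ht S) n T
      = ENNReal.ofReal (t * (W.cTX + W.phi * S) / W.NS) := by
  have hm : Measurable fun D : Instruction W => ENNReal.ofReal (cost W (D n)) :=
    ((measurable_cost W).comp (measurable_pi_apply n)).ennreal_ofReal
  have hk : ∀ k, ∫⁻ D, ENNReal.ofReal (cost W (D k n)) ∂(law (constantPolicy W ht S))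
      = ENNReal.ofReal (t * (W.cTX + W.phi * S) / W.NS) := by
    intro k
    rw [← lintegral_cost_uniformSchedule hW ht S n, ← law_constantPolicy_map ht S k,
      lintegral_map hm (measurable_pi_apply k)]
  have hmk : ∀ k, Measurable fun D : ℕ → Instruction W => ENNReal.ofReal (cost W (D k n)) :=
    fun k => hm.comp (measurable_pi_apply k)
  have hT : (0 : ℝ) < (T : ℝ) + 1 := by positivity
  unfold avgCost
  simp only [ENNReal.ofReal_mul (one_div_pos.2 hT).le,
    ENNReal.ofReal_sum_of_nonneg fun k _ => cost_nonneg hW _]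
  rw [lintegral_const_mul _ (Finset.measurable_sum _ fun k _ => hmk k),
    lintegral_finsetSum _ fun k _ => hmk k,
    Finset.sum_congr rfl fun k _ => hk k]
  simp only [Finset.sum_const, Finset.card_range, nsmul_eq_mul]
  rw [← mul_assoc, ← ENNReal.ofReal_natCast, ← ENNReal.ofReal_mul (one_div_pos.2 hT).le]
  push_cast
  rw [one_div_mul_cancel hT.ne', ENNReal.ofReal_one, one_mul]

/-- The parameters of the theorem, in the form used by `aggSNR_affine_bound`. -/
lemma parameters_of_case (hW : W.Admissible) {ε : ℝ} {t : ℕ} {S : ℝ≥0}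
    (hcase :
      (1 ≤ t ∧ ε = t * W.cTX * (1 + Real.sqrt (W.theta * W.SA)) ∧
        (S : ℝ) = Real.sqrt (W.SA / W.theta)) ∨
      (ε > W.B * W.cTX * (1 + Real.sqrt (W.theta * W.SA)) ∧ t = W.B ∧
        (S : ℝ) = (1 / W.theta) * (ε / (W.B * W.cTX) - 1))) :
    ε = t * (W.cTX + W.phi * S) ∧ W.SA * W.cTX ≤ W.phi * (S : ℝ) ^ 2 ∧
      (W.SA * W.cTX = W.phi * (S : ℝ) ^ 2 ∨ t = W.B) := by
  have hSA := hW.SA_pos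
  have hφ := hW.phi_pos
  have hc := hW.cTX_pos
  have hB : (0 : ℝ) < W.B := by exact_mod_cast hW.B_pos
  have hθ : 0 < W.theta := div_pos hφ hc
  have hφθ : W.phi = W.theta * W.cTX := by
    unfold Network.theta
    field_simp
  rcases hcase with ⟨_, hε, hS⟩ | ⟨hε, rfl, hS⟩
  · have hS2 : (S : ℝ) ^ 2 = W.SA / W.theta := by
      rw [hS]
      exact Real.sq_sqrt (by positivity)
    -- This identity turns `c_TX * (1 + √(θ S_A))` into `c_TX + φ S`, the cost of one active node.
    have hs : Real.sqrt (W.theta * W.SA) = W.theta * S := by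
      rw [Real.sqrt_eq_iff_mul_self_eq (by positivity) (by positivity)]
      have : W.theta * S * (W.theta * S) = W.theta ^ 2 * (S : ℝ) ^ 2 := by ring
      rw [this, hS2]
      field_simp
    have heq : W.SA * W.cTX = W.phi * (S : ℝ) ^ 2 := by
      rw [hS2, hφθ]
      field_simp
    refine ⟨?_, heq.le, Or.inl heq⟩
    rw [hε, hs, hφθ]
    ring
  · have hε' : ε = W.B * (W.cTX + W.phi * S) := by
      rw [hS, hφθ]
      field_simp
      ring
    refine ⟨hε', ?_, Or.inr rfl⟩
    -- The budget beyond the threshold of case (ii) pushes `S` above `√(S_A / θ)`, the measurement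
    -- SNR at which the channel price vanishes.
    have h1 : Real.sqrt (W.theta * W.SA) < W.theta * S := by
      rw [hε', hφθ] at hε
      have h2 : W.B * W.cTX * Real.sqrt (W.theta * W.SA) < W.B * W.cTX * (W.theta * S) := by
        linear_combination hε
      exact lt_of_mul_lt_mul_left h2 (by positivity)
    have h3 := (Real.sqrt_lt' ((Real.sqrt_nonneg _).trans_lt h1)).1 h1
    have h4 : W.theta * W.SA ≤ W.theta * (W.theta * (S : ℝ) ^ 2) := by
      linear_combination h3
    have h5 := mul_le_mul_of_nonneg_right (le_of_mul_le_mul_left h4 hθ) hc.le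
    rw [hφθ]
    linear_combination h5

end WSN

end

theorem mainTheorem1 (W : WSN.Network) (hW : W.Admissible) (ε : ℝ)
    (t : ℕ) (ht : t ≤ W.B) (S : ℝ≥0)
    (hcase :
      (1 ≤ t ∧ ε = t * W.cTX * (1 + Real.sqrt (W.theta * W.SA)) ∧
        (S : ℝ) = Real.sqrt (W.SA / W.theta)) ∨
      (ε > W.B * W.cTX * (1 + Real.sqrt (W.theta * W.SA)) ∧ t = W.B ∧
        (S : ℝ) = (1 / W.theta) * (ε / (W.B * W.cTX) - 1))) :
    let δ : WSN.Policy W := WSN.constantPolicy W ht S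
    let Λ : ℝ := t * (W.SA * S / (W.SA + S))
    WSN.IsOptimal ε δ ∧
    WSN.IsMaxSNR ε δ ∧
    (∀ᵐ D ∂(WSN.law δ), ∀ k, WSN.aggSNR (D k) = Λ) ∧
    WSN.longRunMSE δ = WSN.nuStar W.alpha Λ ∧
    Tendsto (WSN.avgMSE δ) atTop (𝓝 (WSN.nuStar W.alpha Λ)) ∧
    (∀ n, WSN.longRunCost δ n = ENNReal.ofReal (ε / W.NS)) ∧
    (∀ n, Tendsto (WSN.avgCost δ n) atTop (𝓝 (ENNReal.ofReal (ε / W.NS)))) ∧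
    IsGreatest (WSN.attainableSNR W ε) Λ ∧
    (∀ δ' : WSN.Policy W, WSN.IsFeasible ε δ' →
      WSN.nuStar W.alpha Λ ≤ liminf (WSN.avgMSE δ') atTop) := by

  intro δ Λ
  have h0 := hW.alpha_nonneg
  have h1 := hW.alpha_lt_one
  have hSA := hW.SA_pos
  have hφ := hW.phi_pos
  have hc := hW.cTX_pos
  have hS : (0 : ℝ) ≤ S := NNReal.zero_le_coe
  obtain ⟨hε, hle, hor⟩ := WSN.parameters_of_case hW hcase
  have hε0 : 0 ≤ ε := by rw [hε]; positivity
  have hΛ : 0 ≤ Λ := by positivity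
  -- This one affine bound yields both the single-slot maximum and the long-run lower bound.
  obtain ⟨l, hl, hbound⟩ := WSN.aggSNR_affine_bound hW hS hε hle hor
  have hMSE : Tendsto (WSN.avgMSE δ) atTop (𝓝 (WSN.nuStar W.alpha Λ)) :=
    (WSN.tendsto_sampleMSE_const h0 h1 hΛ).congr fun T =>
      (WSN.avgMSE_constantPolicy hW ht S T).symm
  have hcost : ∀ n, Tendsto (WSN.avgCost δ n) atTop (𝓝 (ENNReal.ofReal (ε / W.NS))) := by
    intro n
    refine tendsto_const_nhds.congr fun T => ?_
    rw [hε]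
    exact (WSN.avgCost_constantPolicy hW ht S n T).symm
  have hlower : ∀ δ' : WSN.Policy W, WSN.IsFeasible ε δ' →
      WSN.nuStar W.alpha Λ ≤ liminf (WSN.avgMSE δ') atTop :=
    WSN.nuStar_le_liminf_avgMSE hW hΛ hl hε0 hbound
  have hslot : WSN.SlotFeasible ε (WSN.uniformSchedule (W := W) ht S) := by
    intro n
    rw [hε]
    exact (WSN.lintegral_cost_uniformSchedule hW ht S n).le
  have hint := WSN.integral_aggSNR_uniformSchedule hW ht S
  refine ⟨⟨fun n => (hcost n).limsup_eq.le, fun δ' hδ' => ?_⟩,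
    ⟨WSN.uniformSchedule ht S, fun _ _ => rfl, inferInstance, hslot, fun μ' _ hμ' => ?_⟩,
    WSN.ae_law_constantPolicy hW ht S, hMSE.limsup_eq, hMSE, fun n => (hcost n).limsup_eq, hcost,
    ⟨⟨WSN.uniformSchedule ht S, inferInstance, hslot, hint.symm⟩, ?_⟩, hlower⟩
  · have hb := WSN.isBoundedUnder_avgMSE hW δ'
    exact hMSE.limsup_eq.le.trans ((hlower δ' hδ').trans (liminf_le_limsup hb.1 hb.2))
  · rw [hint]
    exact WSN.integral_aggSNR_le hW hl hε0 hbound μ' hμ'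
  · rintro x ⟨μ', _, hμ', rfl⟩
    exact WSN.integral_aggSNR_le hW hl hε0 hbound μ' hμ'
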